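/- For nonzero integers $s_1,\dots,s_r$ let $$\zeta(s_1,\dots,s_r)=\lim_{N\to\infty}\ \sum_{N\ge n_1>n_2>\cdots>n_r\ge1}\ \prod_{j=1}^r\frac{\operatorname{sgn}(s_j)^{n_j}}{n_j^{|s_j|}}$$ whenever the limit exists. Write $\bar s$ for an entry $-s$ (with $s>0$), and $\{1\}_d$ for the entry $1$ repeated $d$ times. Let $m,k,p\ge 0$ be integers. Then all the values of $\zeta$ below exist, and $$\begin{aligned} &(-1)^{k+p}(m+1)!(k+1)!\sum_{i=0}^{m}\frac{(\ln 2)^i}{i!}\,\zeta(\bar 1,\{1\}_{m-i},2,\{1\}_p,2,\{1\}_k)\\ &+(-1)^{m+1}(k+1)!(m+1)!\sum_{i=0}^{k}\frac{(\ln 2)^i}{i!}\,\zeta(\bar 1,\{1\}_{k-i},2,\{1\}_p,2,\{1\}_m)\\ &+(-1)^{k+p}(k+1)!(\ln 2)^{m+1}\,\zeta(\bar 2,\{1\}_p,2,\{1\}_k) +(-1)^{m+1}(m+1)!(\ln 2)^{k+1}\,\zeta(\bar 2,\{1\}_p,2,\{1\}_m)\\ ={}&(-1)^{m+k+p+1}(m+1)!(k+1)!\,\zeta(\bar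 2,\{1\}_m)\,\zeta(\bar 1,\{1\}_p,2,\{1\}_k)\\ &+(-1)^{m+k}(k+1)!(m+1)!\,\zeta(\bar 2,\{1\}_k)\,\zeta(\bar 1,\{1\}_p,2,\{1\}_m)\\ &+(-1)^{m+k+p+1}(k+1)!(m+1)!\sum_{i=1}^{p}(-1)^i\,\zeta(\bar 1,\{1\}_{i-1},2,\{1\}_m)\,\zeta(\bar 1,\{1\}_{p-i},2,\{1\}_k). \end{aligned}$$ -/

import Mathlib

open Filter Topology

/-- Multiple harmonic number `ζ_n(s₁, …, s_k)`, the sum over `n ≥ n₁ > n₂ > ⋯ > n_k ≥ 1` of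
`∏ j, sgn(s_j)^(n_j) / n_j^|s_j|`, written by summing over the outermost index `n₁` first
(the remaining indices then run over `n₁ - 1 ≥ n₂ > ⋯ > n_k ≥ 1`).
The value at the empty index is `1`. A barred entry is encoded as a negative integer. -/
noncomputable def multipleHarmonic : List ℤ → ℕ → ℝ
  | [], _ => 1
  | s :: t, n =>
      ∑ j ∈ Finset.Icc 1 n,
        ((Int.sign s : ℤ) : ℝ) ^ j / (j : ℝ) ^ s.natAbs * multipleHarmonic t (j - 1)

/-- The series defining the multiple zeta value `ζ(s₁, …, s_k)` converges, that is, its partial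
sums over `n₁ ≤ n` have a finite limit. -/
def MZVConverges (s : List ℤ) : Prop :=
  ∃ x : ℝ, Tendsto (multipleHarmonic s) atTop (𝓝 x)

/-- The (alternating) multiple zeta value `ζ(s₁, …, s_k)`, the limit of its partial sums over
`n₁ ≤ n` (meaningful when `MZVConverges s`). -/
noncomputable def mzv (s : List ℤ) : ℝ :=
  limUnder atTop (multipleHarmonic s)

/-- The string `{1}_d`, in which `1` is repeated `d` times. -/
def ones (d : ℕ) : List ℤ := List.replicate d 1

/-! ### Alternating convolutions and derivations -/

/-! Only the leading entry is barred, so every zeta value here is a one-variable multiple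
polylogarithm `Li_t(x)` at `x = -1`. For `D = x(1-x) d/dx` one has `D Li_{1,t} = x Li_t` and `D
Li_{2,t} = (1-x) Li_{1,t}`. Prefixing ones thus yields sequences with `D u_{n+1} = x u_n`; under `D`
an alternating convolution of two such sequences telescopes to two boundary terms
(`Derivation.map_altConv`). The three convolutions in `altConv_polylog_identity` have matching
boundary terms and zero constant term, which gives the identity of power series.

It passes to `x = -1` by Abel's theorem. Convergence there follows from an `O(√n)` bound on multiple
harmonic numbers and summation by parts; powers of `ln 2` come from `Li_{{1}_d} = (-log(1-x))^d /
d!`. -/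

/-- The alternating convolution `∑ i + j = n, (-1) ^ i * u i * v j`. -/
def altConv {R : Type*} [CommRing R] (u v : ℕ → R) (n : ℕ) : R :=
  ∑ q ∈ Finset.HasAntidiagonal.antidiagonal n, (-1) ^ q.1 * u q.1 * v q.2

/-- Differentiating the left factor of one term cancels differentiating the right factor of its
predecessor, so only the two ends survive. -/
theorem Derivation.map_altConv {S R : Type*} [CommRing S] [CommRing R] [Algebra S R]
    (δ : Derivation S R R) (x : R) (u v : ℕ → R) (hu : ∀ n, δ (u (n + 1)) = x * u n)
    (hv : ∀ n, δ (v (n + 1)) = x * v n) (n : ℕ) :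
    δ (altConv u v n) = δ (u 0) * v n + (-1) ^ n * u n * δ (v 0) := by
  have hsign : ∀ (i : ℕ) (a b : R), δ ((-1) ^ i * a * b) =
      (-1) ^ i * δ a * b + (-1) ^ i * a * δ b := by
    intro i a b
    have h1 : δ ((-1) ^ i) = 0 := by simp [Derivation.leibniz_pow]
    rw [Derivation.leibniz, Derivation.leibniz, h1]
    simp only [smul_eq_mul]
    ring
  simp only [altConv, map_sum, hsign, Finset.sum_add_distrib]
  cases n with
  | zero => simp
  | succ n =>
    rw [Finset.Nat.sum_antidiagonal_succ, Finset.Nat.sum_antidiagonal_succ']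
    simp only [hu, hv]
    have hcancel : ∑ q ∈ Finset.HasAntidiagonal.antidiagonal n, (-1) ^ (q.1 + 1) * (x * u q.1) * v q.2
        = -∑ q ∈ Finset.HasAntidiagonal.antidiagonal n, (-1) ^ q.1 * u q.1 * (x * v q.2) := by
      rw [← Finset.sum_neg_distrib]
      exact Finset.sum_congr rfl fun q _ => by ring
    rw [hcancel]
    ring

theorem altConv_eq_sum_range {R : Type*} [CommRing R] (u v : ℕ → R) (n : ℕ) :
    altConv u v n = ∑ i ∈ Finset.range (n + 1), (-1) ^ i * u i * v (n - i) :=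
  Finset.Nat.sum_antidiagonal_eq_sum_range_succ (fun i j => (-1) ^ i * u i * v j) n

/-! ### Multiple polylogarithms as formal power series -/

open PowerSeries

theorem multipleHarmonic_cons_succ (s : ℤ) (t : List ℤ) (n : ℕ) :
    multipleHarmonic (s :: t) (n + 1) = multipleHarmonic (s :: t) n +
      ((Int.sign s : ℤ) : ℝ) ^ (n + 1) / ((n + 1 : ℕ) : ℝ) ^ s.natAbs * multipleHarmonic t n := by
  simp only [multipleHarmonic]
  rw [Finset.sum_Icc_succ_top (by omega)]
  simp

theorem multipleHarmonic_cons_zero (s : ℤ) (t : List ℤ) : multipleHarmonic (s :: t) 0 = 0 := by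
  simp [multipleHarmonic]

/-- The coefficients of the multiple polylogarithm in one variable. -/
noncomputable def polylogCoeff : List ℤ → ℕ → ℝ
  | [], n => if n = 0 then 1 else 0
  | s :: t, n => multipleHarmonic t (n - 1) / (n : ℝ) ^ s.natAbs

/-- The multiple polylogarithm `∑ n₁ > ⋯ > n_r ≥ 1, X ^ n₁ / ∏ n_j ^ |s_j|`. -/
noncomputable def polylog (t : List ℤ) : ℝ⟦X⟧ := PowerSeries.mk (polylogCoeff t)

/-- Relies on division by zero being `0`: the denominator is `0 ^ |s|` with `s ≠ 0`. -/
theorem polylogCoeff_cons_zero {s : ℤ} (hs : 0 < s) (t : List ℤ) :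
    polylogCoeff (s :: t) 0 = 0 := by
  have : s.natAbs ≠ 0 := by omega
  simp [polylogCoeff, this]

theorem constantCoeff_polylog_cons {s : ℤ} (hs : 0 < s) (t : List ℤ) :
    constantCoeff (polylog (s :: t)) = 0 := by
  rw [← coeff_zero_eq_constantCoeff_apply, polylog, coeff_mk, polylogCoeff_cons_zero hs]

theorem polylog_nil : polylog [] = 1 := by
  ext n
  simp [polylog, polylogCoeff, coeff_one]

/-- Multiplication by `1 - X` takes successive differences, and the increments of the partial sums
are the polylogarithm coefficients. -/
theorem one_sub_X_mul_mk_multipleHarmonic {t : List ℤ} (ht : ∀ s ∈ t, 0 < s) :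
    (1 - X) * PowerSeries.mk (multipleHarmonic t) = polylog t := by
  ext n
  rw [sub_mul, one_mul, map_sub, polylog, coeff_mk, coeff_mk]
  cases t with
  | nil => cases n <;> simp [polylogCoeff, multipleHarmonic, coeff_succ_X_mul]
  | cons s t =>
    have hs : 0 < s := ht s (by simp)
    cases n with
    | zero => simp [polylogCoeff_cons_zero hs, multipleHarmonic_cons_zero]
    | succ n =>
      rw [coeff_succ_X_mul, coeff_mk, multipleHarmonic_cons_succ, Int.sign_eq_one_of_pos hs]
      simp [polylogCoeff]
      ring

/-- The derivation `X (1 - X) d/dX` on power series. -/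
noncomputable def eulerDerivation : Derivation ℝ ℝ⟦X⟧ ℝ⟦X⟧ :=
  (X * (1 - X) : ℝ⟦X⟧) • (d⁄dX ℝ)

theorem eulerDerivation_apply (f : ℝ⟦X⟧) :
    eulerDerivation f = X * (1 - X) * (d⁄dX ℝ) f := rfl

/-- The derivative is the generating series of partial sums, `polylog t / (1 - X)`; the factor `1 -
X` in the derivation clears this denominator. -/
theorem eulerDerivation_polylog_one_cons {t : List ℤ} (ht : ∀ s ∈ t, 0 < s) :
    eulerDerivation (polylog (1 :: t)) = X * polylog t := by
  have h : (d⁄dX ℝ) (polylog (1 :: t)) = PowerSeries.mk (multipleHarmonic t) := by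
    ext n
    rw [coeff_derivative, polylog, coeff_mk, coeff_mk]
    have : (n : ℝ) + 1 ≠ 0 := by positivity
    simp [polylogCoeff]
    field_simp
  rw [eulerDerivation_apply, h, mul_assoc, one_sub_X_mul_mk_multipleHarmonic ht]

theorem eulerDerivation_polylog_two_cons (t : List ℤ) :
    eulerDerivation (polylog (2 :: t)) = (1 - X) * polylog (1 :: t) := by
  have h : X * (d⁄dX ℝ) (polylog (2 :: t)) = polylog (1 :: t) := by
    ext n
    cases n with
    | zero => simp [polylog, polylogCoeff]
    | succ n =>
      rw [coeff_succ_X_mul, coeff_derivative, polylog, polylog, coeff_mk, coeff_mk]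
      have : (n : ℝ) + 1 ≠ 0 := by positivity
      simp [polylogCoeff]
      field_simp
  rw [eulerDerivation_apply, ← h]
  ring

theorem eq_of_eulerDerivation_eq {f g : ℝ⟦X⟧} (h : eulerDerivation f = eulerDerivation g)
    (h0 : constantCoeff f = constantCoeff g) : f = g := by
  refine PowerSeries.derivative.ext ?_ h0
  rw [eulerDerivation_apply, eulerDerivation_apply] at h
  refine mul_left_cancel₀ (mul_ne_zero X_ne_zero ?_) h
  intro hX
  have := congrArg constantCoeff hX
  simp at this

theorem ones_succ (d : ℕ) : ones (d + 1) = 1 :: ones d := rfl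

theorem pos_of_mem_ones {d : ℕ} : ∀ s ∈ ones d, 0 < s := by
  intro s hs
  rw [List.eq_of_mem_replicate hs]
  norm_num

theorem pos_of_mem_ones_append_two_cons {d : ℕ} {t : List ℤ} (ht : ∀ s ∈ t, 0 < s) :
    ∀ s ∈ ones d ++ 2 :: t, 0 < s := by
  intro s hs
  rcases List.mem_append.1 hs with h | h
  · exact pos_of_mem_ones s h
  · rcases List.mem_cons.1 h with rfl | h
    · norm_num
    · exact ht s h

/-- The multiple polylogarithm of `({1}_d, 2, t)`. -/
noncomputable def polylogOnesTwo (t : List ℤ) (d : ℕ) : ℝ⟦X⟧ := polylog (ones d ++ 2 :: t)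

theorem constantCoeff_polylogOnesTwo (t : List ℤ) (d : ℕ) :
    constantCoeff (polylogOnesTwo t d) = 0 := by
  cases d with
  | zero => exact constantCoeff_polylog_cons (by norm_num) t
  | succ d => exact constantCoeff_polylog_cons (by norm_num) _

theorem eulerDerivation_polylogOnesTwo_succ {t : List ℤ} (ht : ∀ s ∈ t, 0 < s) (d : ℕ) :
    eulerDerivation (polylogOnesTwo t (d + 1)) = X * polylogOnesTwo t d :=
  eulerDerivation_polylog_one_cons (pos_of_mem_ones_append_two_cons ht)

theorem eulerDerivation_polylogOnesTwo_zero (t : List ℤ) :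
    eulerDerivation (polylogOnesTwo t 0) = (1 - X) * polylog (1 :: t) :=
  eulerDerivation_polylog_two_cons t

theorem eulerDerivation_polylog_ones_succ (d : ℕ) :
    eulerDerivation (polylog (ones (d + 1))) = X * polylog (ones d) :=
  eulerDerivation_polylog_one_cons pos_of_mem_ones

theorem eulerDerivation_polylog_ones_zero : eulerDerivation (polylog (ones 0)) = 0 := by
  rw [show ones 0 = [] from rfl, polylog_nil, Derivation.map_one_eq_zero]

/-- Inductively, both sides have the same image under the derivation and the same constant term. -/
theorem factorial_mul_polylog_ones (d : ℕ) :
    (d.factorial : ℝ⟦X⟧) * polylog (ones d) = polylog [1] ^ d := by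
  induction d with
  | zero => simp [show ones 0 = [] from rfl, polylog_nil]
  | succ d ih =>
    apply eq_of_eulerDerivation_eq
    · rw [Derivation.leibniz, Derivation.leibniz_pow, Derivation.map_natCast,
        eulerDerivation_polylog_ones_succ, eulerDerivation_polylog_one_cons (by simp),
        polylog_nil, Nat.add_sub_cancel, ← ih, Nat.factorial_succ]
      simp only [smul_eq_mul, nsmul_eq_mul]
      push_cast
      ring
    · rw [map_mul, map_pow, ones_succ, constantCoeff_polylog_cons one_pos,
        constantCoeff_polylog_cons one_pos]
      simp

theorem constantCoeff_altConv_polylogOnesTwo (u : ℕ → ℝ⟦X⟧) (t : List ℤ) (n : ℕ) :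
    constantCoeff (altConv u (polylogOnesTwo t) n) = 0 := by
  simp [altConv, map_sum, constantCoeff_polylogOnesTwo]

theorem altConv_polylog_identity (m k p : ℕ) :
    (-1) ^ (k + p) *
        altConv (fun i => polylog (ones i)) (polylogOnesTwo (ones p ++ 2 :: ones k)) (m + 1) +
      (-1) ^ (m + 1) *
        altConv (fun i => polylog (ones i)) (polylogOnesTwo (ones p ++ 2 :: ones m)) (k + 1) =
    (-1) ^ (m + k + p + 1) *
      altConv (polylogOnesTwo (ones m)) (polylogOnesTwo (ones k)) (p + 1) := by
  have hsign : ∀ (i : ℕ) (a : ℝ⟦X⟧),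
      eulerDerivation ((-1) ^ i * a) = (-1) ^ i * eulerDerivation a := by
    intro i a
    rcases neg_one_pow_eq_or ℝ⟦X⟧ i with h | h <;> simp [h]
  have hv : ∀ (p k : ℕ), polylog (1 :: (ones p ++ 2 :: ones k)) = polylogOnesTwo (ones k) (p + 1) :=
    fun _ _ => rfl
  have hl : ∀ k : ℕ, polylog (1 :: ones k) = polylog (ones (k + 1)) := fun _ => rfl
  apply eq_of_eulerDerivation_eq
  · rw [map_add, hsign, hsign, hsign,
      Derivation.map_altConv _ X _ _ eulerDerivation_polylog_ones_succ
        (eulerDerivation_polylogOnesTwo_succ (pos_of_mem_ones_append_two_cons pos_of_mem_ones)),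
      Derivation.map_altConv _ X _ _ eulerDerivation_polylog_ones_succ
        (eulerDerivation_polylogOnesTwo_succ (pos_of_mem_ones_append_two_cons pos_of_mem_ones)),
      Derivation.map_altConv _ X _ _ (eulerDerivation_polylogOnesTwo_succ pos_of_mem_ones)
        (eulerDerivation_polylogOnesTwo_succ pos_of_mem_ones)]
    simp only [eulerDerivation_polylog_ones_zero, eulerDerivation_polylogOnesTwo_zero, hv, hl]
    -- The boundary term containing `polylog (ones (k + 1))` carries `(-1) ^ p` twice on the right
    -- and not at all on the left.
    have hp : ((-1 : ℝ⟦X⟧) ^ p) * (-1) ^ p = 1 := by rw [← mul_pow]; simp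
    simp only [pow_add, pow_one]
    linear_combination ((-1) ^ m * (-1) ^ k * polylogOnesTwo (ones m) (p + 1) * (1 - X) *
      polylog (ones (k + 1))) * (-hp)
  · simp only [map_add, map_mul, constantCoeff_altConv_polylogOnesTwo, mul_zero, add_zero]

/-! ### Growth of multiple harmonic numbers and convergence of alternating series -/

theorem multipleHarmonic_nonneg {t : List ℤ} (ht : ∀ s ∈ t, 0 < s) (n : ℕ) :
    0 ≤ multipleHarmonic t n := by
  induction t generalizing n with
  | nil => simp [multipleHarmonic]
  | cons s t ih =>
    rw [multipleHarmonic, Int.sign_eq_one_of_pos (ht s (by simp))]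
    refine Finset.sum_nonneg fun j _ => ?_
    have := ih (fun s hs => ht s (by simp [hs])) (j - 1)
    simp only [Int.cast_one, one_pow]
    positivity

theorem inv_natCast_pow_natAbs_le {s : ℤ} (hs : 0 < s) (n : ℕ) :
    1 / ((n + 1 : ℕ) : ℝ) ^ s.natAbs ≤ 1 / ((n : ℝ) + 1) := by
  have h1 : (1 : ℝ) ≤ (n : ℝ) + 1 := by
    have : (0 : ℝ) ≤ n := Nat.cast_nonneg n
    linarith
  apply one_div_le_one_div_of_le (by positivity)
  push_cast
  exact le_self_pow₀ h1 (by omega)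

/-- A crude bound that reproduces itself under `∑ 1/√j ≤ 2√n`, one factor `2` per entry. -/
theorem multipleHarmonic_le {t : List ℤ} (ht : ∀ s ∈ t, 0 < s) (n : ℕ) :
    multipleHarmonic t n ≤ 2 ^ t.length * √((n : ℝ) + 1) := by
  induction t generalizing n with
  | nil => simp [multipleHarmonic]
  | cons s t ih =>
    have hs : 0 < s := ht s (by simp)
    have ht' : ∀ s ∈ t, 0 < s := fun s hs => ht s (by simp [hs])
    -- The unshifted `√n` is needed for the induction on `n`: `2(√(n+1) - √n) ≥ 1/√(n+1)`, whereas
    -- `2(√(n+2) - √(n+1))` is too small.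
    suffices h : multipleHarmonic (s :: t) n ≤ 2 ^ (s :: t).length * √(n : ℝ) by
      refine h.trans ?_
      gcongr
      linarith
    induction n with
    | zero => simp [multipleHarmonic_cons_zero]
    | succ n ihn =>
      rw [multipleHarmonic_cons_succ, Int.sign_eq_one_of_pos hs]
      have hstep : ((1 : ℤ) : ℝ) ^ (n + 1) / ((n + 1 : ℕ) : ℝ) ^ s.natAbs * multipleHarmonic t n ≤
          1 / ((n : ℝ) + 1) * (2 ^ t.length * √((n : ℝ) + 1)) := by
        rw [Int.cast_one, one_pow]
        exact mul_le_mul (inv_natCast_pow_natAbs_le hs n) (ih ht' n)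
          (multipleHarmonic_nonneg ht' n) (by positivity)
      have hsqrt : 1 / ((n : ℝ) + 1) * √((n : ℝ) + 1) ≤ 2 * (√((n : ℝ) + 1) - √n) := by
        have hy : 0 < √((n : ℝ) + 1) := by positivity
        have hyy : √((n : ℝ) + 1) ^ 2 = (n : ℝ) + 1 := Real.sq_sqrt (by positivity)
        have hzz : √(n : ℝ) ^ 2 = n := Real.sq_sqrt (by positivity)
        rw [one_div_mul_eq_div, div_le_iff₀ (by positivity)]
        set y := √((n : ℝ) + 1)
        set z := √(n : ℝ)
        -- Since `y² - z² = 1`, the right side equals `1 + (y - z)²`.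
        have h1 : 1 ≤ 2 * (y - z) * y := by nlinarith [sq_nonneg (y - z)]
        calc y ≤ y * (2 * (y - z) * y) := le_mul_of_one_le_right hy.le h1
          _ = 2 * (y - z) * ((n : ℝ) + 1) := by rw [← hyy]; ring
      rw [List.length_cons, pow_succ (2 : ℝ)] at ihn ⊢
      rw [Nat.cast_succ] at hstep ⊢
      have := mul_le_mul_of_nonneg_left hsqrt (show (0 : ℝ) ≤ 2 ^ t.length by positivity)
      linarith

/-- Summation by parts: bounded variation replaces the monotonicity in Leibniz's test. -/
theorem tendsto_sum_alternating {a : ℕ → ℝ} (ha : Tendsto a atTop (𝓝 0))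
    (hd : Summable fun n => |a (n + 1) - a n|) :
    ∃ y, Tendsto (fun N => ∑ n ∈ Finset.range N, (-1) ^ n * a n) atTop (𝓝 y) := by
  have hs : Summable fun n => (-1) ^ n * (a (n + 1) - a n) := by
    refine Summable.of_norm ?_
    simpa [abs_mul] using hd
  have hsum : ∀ N, ∑ n ∈ Finset.range N, (-1) ^ n * a n =
      (a 0 - (-1) ^ N * a N - ∑ n ∈ Finset.range N, (-1) ^ n * (a (n + 1) - a n)) / 2 := by
    intro N
    induction N with
    | zero => simp
    | succ N ih => rw [Finset.sum_range_succ, ih, Finset.sum_range_succ]; ring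
  have hz : Tendsto (fun N => (-1) ^ N * a N) atTop (𝓝 0) := by
    rw [tendsto_zero_iff_abs_tendsto_zero] at ha ⊢
    refine ha.congr fun N => ?_
    simp [abs_mul]
  refine ⟨_, Tendsto.congr (fun N => (hsum N).symm)
    (((tendsto_const_nhds.sub hz).sub hs.hasSum.tendsto_sum_nat).div_const 2)⟩

theorem summable_sqrt_div_sq : Summable fun n : ℕ => √((n : ℝ) + 1) / ((n : ℝ) + 1) ^ 2 := by
  have h := (summable_nat_add_iff 1).2 (Real.summable_one_div_nat_rpow.2 (by norm_num : (1:ℝ) < 3 / 2))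
  refine h.congr fun n => ?_
  have hx : (0 : ℝ) < (n : ℝ) + 1 := by positivity
  push_cast
  rw [Real.sqrt_eq_rpow, ← Real.rpow_natCast, ← Real.rpow_sub hx, one_div, ← Real.rpow_neg hx.le]
  norm_num

theorem multipleHarmonic_succ_sub_nonneg {t : List ℤ} (ht : ∀ s ∈ t, 0 < s) (n : ℕ) :
    0 ≤ multipleHarmonic t (n + 1) - multipleHarmonic t n ∧
    multipleHarmonic t (n + 1) - multipleHarmonic t n ≤
      2 ^ t.length * √((n : ℝ) + 1) / ((n : ℝ) + 1) := by
  cases t with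
  | nil => simp only [multipleHarmonic, sub_self, le_refl, true_and]; positivity
  | cons s t =>
    have hs : 0 < s := ht s (by simp)
    have ht' : ∀ s ∈ t, 0 < s := fun s hs => ht s (by simp [hs])
    rw [multipleHarmonic_cons_succ, Int.sign_eq_one_of_pos hs, add_sub_cancel_left, Int.cast_one,
      one_pow]
    have h0 := multipleHarmonic_nonneg ht' n
    refine ⟨by positivity, ?_⟩
    calc _ ≤ 1 / ((n : ℝ) + 1) * (2 ^ t.length * √((n : ℝ) + 1)) :=
          mul_le_mul (inv_natCast_pow_natAbs_le hs n) (multipleHarmonic_le ht' n) h0 (by positivity)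
      _ = 2 ^ t.length * √((n : ℝ) + 1) / ((n : ℝ) + 1) := by ring
      _ ≤ _ := by
          have : (2 : ℝ) ^ t.length ≤ 2 ^ (s :: t).length :=
            pow_le_pow_right₀ (by norm_num) (by simp)
          gcongr

theorem polylogCoeff_cons_succ (s : ℤ) (t : List ℤ) (n : ℕ) :
    polylogCoeff (s :: t) (n + 1) = multipleHarmonic t n / ((n : ℝ) + 1) ^ s.natAbs := by
  simp [polylogCoeff]

theorem polylogCoeff_nonneg {t : List ℤ} (ht : ∀ s ∈ t, 0 < s) (s : ℤ) (n : ℕ) :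
    0 ≤ polylogCoeff (s :: t) n :=
  div_nonneg (multipleHarmonic_nonneg ht _) (by positivity)

theorem tendsto_sqrt_div : Tendsto (fun n : ℕ => √((n : ℝ) + 1) / ((n : ℝ) + 1)) atTop (𝓝 0) := by
  have h : Tendsto (fun n : ℕ => (n : ℝ) + 1) atTop atTop :=
    tendsto_atTop_add_const_right _ _ tendsto_natCast_atTop_atTop
  refine (tendsto_inv_atTop_zero.comp (Real.tendsto_sqrt_atTop.comp h)).congr fun n => ?_
  have hx : (0 : ℝ) < (n : ℝ) + 1 := by positivity
  simp only [Function.comp_apply]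
  rw [Real.sqrt_div_self']
  simp

theorem multipleHarmonic_neg_cons {s : ℤ} (hs : 0 < s) (t : List ℤ) (N : ℕ) :
    multipleHarmonic (-s :: t) N =
      ∑ n ∈ Finset.range (N + 1), (-1) ^ n * polylogCoeff (s :: t) n := by
  induction N with
  | zero => simp [multipleHarmonic_cons_zero, polylogCoeff_cons_zero hs]
  | succ N ih =>
    rw [multipleHarmonic_cons_succ, ih, Finset.sum_range_succ _ (N + 1), Int.sign_neg,
      Int.sign_eq_one_of_pos hs, polylogCoeff_cons_succ, Int.natAbs_neg]
    push_cast
    ring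

theorem exists_tendsto_sum_polylogCoeff_one {t : List ℤ} (ht : ∀ s ∈ t, 0 < s) :
    ∃ y, Tendsto (fun N => ∑ n ∈ Finset.range N, (-1) ^ n * polylogCoeff (1 :: t) n)
      atTop (𝓝 y) := by
  apply tendsto_sum_alternating
  · rw [← tendsto_add_atTop_iff_nat 1]
    refine squeeze_zero (fun n => polylogCoeff_nonneg ht 1 _) (fun n => ?_)
      (by simpa using tendsto_sqrt_div.const_mul (2 ^ t.length))
    rw [polylogCoeff_cons_succ, Int.natAbs_one, pow_one, ← mul_div_assoc]
    have := multipleHarmonic_le ht n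
    gcongr
  · rw [← summable_nat_add_iff 1]
    refine Summable.of_nonneg_of_le (fun n => abs_nonneg _) (fun n => ?_)
      (summable_sqrt_div_sq.mul_left (2 * 2 ^ t.length))
    rw [polylogCoeff_cons_succ, polylogCoeff_cons_succ, Int.natAbs_one, pow_one, pow_one]
    obtain ⟨h1, h2⟩ := multipleHarmonic_succ_sub_nonneg ht n
    have h3 := multipleHarmonic_nonneg ht n
    have h4 := multipleHarmonic_le ht n
    push_cast
    have hx : (0 : ℝ) < (n : ℝ) + 1 := by positivity
    set x : ℝ := (n : ℝ) + 1
    set C : ℝ := 2 ^ t.length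
    have e : multipleHarmonic t (n + 1) / (x + 1) - multipleHarmonic t n / x =
        (multipleHarmonic t (n + 1) - multipleHarmonic t n) / (x + 1) -
          multipleHarmonic t n / (x * (x + 1)) := by
      field_simp
      ring
    have b1 : (multipleHarmonic t (n + 1) - multipleHarmonic t n) / (x + 1) ≤ C * √x / x / x := by
      apply div_le_div₀ (by positivity) h2 hx (by linarith)
    have b2 : multipleHarmonic t n / (x * (x + 1)) ≤ C * √x / (x * x) := by
      apply div_le_div₀ (by positivity) h4 (by positivity)
      gcongr
      linarith
    have p1 : 0 ≤ (multipleHarmonic t (n + 1) - multipleHarmonic t n) / (x + 1) := by positivity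
    have p2 : 0 ≤ multipleHarmonic t n / (x * (x + 1)) := by positivity
    have e2 : 2 * C * (√x / x ^ 2) = C * √x / x / x + C * √x / (x * x) := by
      field_simp
      ring
    rw [e, e2, abs_le]
    constructor <;> linarith

theorem exists_tendsto_sum_polylogCoeff_two {t : List ℤ} (ht : ∀ s ∈ t, 0 < s) :
    ∃ y, Tendsto (fun N => ∑ n ∈ Finset.range N, (-1) ^ n * polylogCoeff (2 :: t) n)
      atTop (𝓝 y) := by
  have h : Summable fun n => polylogCoeff (2 :: t) n := by
    rw [← summable_nat_add_iff 1]
    refine Summable.of_nonneg_of_le (fun n => polylogCoeff_nonneg ht 2 _) (fun n => ?_)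
      (summable_sqrt_div_sq.mul_left (2 ^ t.length))
    rw [polylogCoeff_cons_succ, ← mul_div_assoc]
    have := multipleHarmonic_le ht n
    exact div_le_div_of_nonneg_right this (by positivity)
  have h' : Summable fun n => (-1) ^ n * polylogCoeff (2 :: t) n := by
    refine Summable.of_norm ?_
    simpa [abs_mul] using h.abs
  exact ⟨_, h'.hasSum.tendsto_sum_nat⟩

theorem mzvConverges_neg_cons {s : ℤ} (hs : 0 < s) {t : List ℤ}
    (h : ∃ y, Tendsto (fun N => ∑ n ∈ Finset.range N, (-1) ^ n * polylogCoeff (s :: t) n)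
      atTop (𝓝 y)) :
    MZVConverges (-s :: t) := by
  obtain ⟨y, hy⟩ := h
  exact ⟨y, ((tendsto_add_atTop_iff_nat 1).2 hy).congr
    fun N => (multipleHarmonic_neg_cons hs t N).symm⟩

theorem mzvConverges_neg_one_cons {t : List ℤ} (ht : ∀ s ∈ t, 0 < s) : MZVConverges (-1 :: t) :=
  mzvConverges_neg_cons one_pos (exists_tendsto_sum_polylogCoeff_one ht)

theorem mzvConverges_neg_two_cons {t : List ℤ} (ht : ∀ s ∈ t, 0 < s) : MZVConverges (-2 :: t) :=
  mzvConverges_neg_cons two_pos (exists_tendsto_sum_polylogCoeff_two ht)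

/-! ### Abel limits at `-1` -/

/-- `f` converges absolutely on the open unit disc and tends to `y` at `-1` from the right. -/
def HasAbelLimit (f : ℝ⟦X⟧) (y : ℝ) : Prop :=
  (∀ x : ℝ, |x| < 1 → Summable fun n => ‖coeff n f * x ^ n‖) ∧
    Tendsto (fun x : ℝ => ∑' n, coeff n f * (-x) ^ n) (𝓝[<] 1) (𝓝 y)

theorem eventually_abs_neg_lt_one : ∀ᶠ x : ℝ in 𝓝[<] 1, |-x| < 1 := by
  filter_upwards [Ioo_mem_nhdsLT (show (0 : ℝ) < 1 by norm_num)] with x hx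
  rw [abs_neg, abs_lt]
  constructor <;> linarith [hx.1, hx.2]

theorem HasAbelLimit.unique {f : ℝ⟦X⟧} {y z : ℝ} (hy : HasAbelLimit f y) (hz : HasAbelLimit f z) :
    y = z :=
  tendsto_nhds_unique hy.2 hz.2

theorem HasAbelLimit.add {f g : ℝ⟦X⟧} {y z : ℝ} (hf : HasAbelLimit f y) (hg : HasAbelLimit g z) :
    HasAbelLimit (f + g) (y + z) := by
  refine ⟨fun x hx => ?_, ?_⟩
  · refine Summable.of_nonneg_of_le (fun n => norm_nonneg _) (fun n => ?_)
      ((hf.1 x hx).add (hg.1 x hx))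
    rw [map_add, add_mul]
    exact norm_add_le _ _
  · refine (hf.2.add hg.2).congr' ?_
    filter_upwards [eventually_abs_neg_lt_one] with x hx
    rw [← (hf.1 _ hx).of_norm.tsum_add (hg.1 _ hx).of_norm]
    simp only [map_add, add_mul]

/-- Cauchy products are taken inside the disc, where convergence is absolute; at `-1` it may be only
conditional. -/
theorem HasAbelLimit.mul {f g : ℝ⟦X⟧} {y z : ℝ} (hf : HasAbelLimit f y) (hg : HasAbelLimit g z) :
    HasAbelLimit (f * g) (y * z) := by
  have e : ∀ (x : ℝ) (n : ℕ), coeff n (f * g) * x ^ n =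
      ∑ q ∈ Finset.HasAntidiagonal.antidiagonal n, (coeff q.1 f * x ^ q.1) * (coeff q.2 g * x ^ q.2) := by
    intro x n
    rw [coeff_mul, Finset.sum_mul]
    refine Finset.sum_congr rfl fun q hq => ?_
    have hq' : q.1 + q.2 = n := Finset.HasAntidiagonal.mem_antidiagonal.1 hq
    rw [← hq', pow_add]
    ring
  refine ⟨fun x hx => ?_, ?_⟩
  · simp only [e]
    exact summable_norm_sum_mul_antidiagonal_of_summable_norm
      (f := fun n => coeff n f * x ^ n) (g := fun n => coeff n g * x ^ n) (hf.1 x hx) (hg.1 x hx)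
  · refine (hf.2.mul hg.2).congr' ?_
    filter_upwards [eventually_abs_neg_lt_one] with x hx
    simp only [e]
    exact tsum_mul_tsum_eq_tsum_sum_antidiagonal_of_summable_norm
      (f := fun n => coeff n f * (-x) ^ n) (g := fun n => coeff n g * (-x) ^ n)
      (hf.1 _ hx) (hg.1 _ hx)

theorem hasAbelLimit_C (c : ℝ) : HasAbelLimit (C c) c := by
  have e : ∀ (x : ℝ) (n : ℕ), n ≠ 0 → coeff n (C c) * x ^ n = 0 := by
    intro x n hn
    simp [coeff_C, hn]
  refine ⟨fun x _ => ?_, ?_⟩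
  · exact summable_of_ne_finset_zero (s := {0}) fun n hn => by
      rw [e x n (by simpa using hn), norm_zero]
  · refine tendsto_const_nhds.congr fun x => ?_
    rw [tsum_eq_single 0 (fun n hn => e _ n hn)]
    simp

theorem HasAbelLimit.pow {f : ℝ⟦X⟧} {y : ℝ} (hf : HasAbelLimit f y) (n : ℕ) :
    HasAbelLimit (f ^ n) (y ^ n) := by
  induction n with
  | zero => simpa using hasAbelLimit_C 1
  | succ n ih => simpa only [pow_succ] using ih.mul hf

theorem hasAbelLimit_neg_one_pow (n : ℕ) : HasAbelLimit ((-1) ^ n) ((-1) ^ n) := by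
  simpa using (hasAbelLimit_C (-1)).pow n

theorem HasAbelLimit.sum {ι : Type*} (s : Finset ι) {f : ι → ℝ⟦X⟧} {y : ι → ℝ}
    (h : ∀ i ∈ s, HasAbelLimit (f i) (y i)) : HasAbelLimit (∑ i ∈ s, f i) (∑ i ∈ s, y i) := by
  classical
  induction s using Finset.induction_on with
  | empty => simpa using hasAbelLimit_C 0
  | insert i s hi ih =>
    rw [Finset.sum_insert hi, Finset.sum_insert hi]
    exact (h i (by simp)).add (ih fun j hj => h j (by simp [hj]))

theorem HasAbelLimit.altConv {u v : ℕ → ℝ⟦X⟧} {y z : ℕ → ℝ} (hu : ∀ n, HasAbelLimit (u n) (y n))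
    (hv : ∀ n, HasAbelLimit (v n) (z n)) (n : ℕ) :
    HasAbelLimit (altConv u v n) (altConv y z n) :=
  HasAbelLimit.sum _ fun q _ => ((hasAbelLimit_neg_one_pow q.1).mul (hu q.1)).mul (hv q.2)

theorem summable_polylogCoeff_cons {s : ℤ} {t : List ℤ} (ht : ∀ s ∈ t, 0 < s) (x : ℝ)
    (hx : |x| < 1) : Summable fun n => ‖polylogCoeff (s :: t) n * x ^ n‖ := by
  have hx' : ‖|x|‖ < 1 := by simpa using hx
  have h := ((summable_pow_mul_geometric_of_norm_lt_one 1 hx').add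
    (summable_pow_mul_geometric_of_norm_lt_one 0 hx')).mul_left (2 ^ t.length)
  rw [← summable_nat_add_iff 1] at h ⊢
  refine Summable.of_nonneg_of_le (fun n => norm_nonneg _) (fun n => ?_) h
  have h0 := multipleHarmonic_nonneg ht n
  have hx1 : (1 : ℝ) ≤ (n : ℝ) + 1 := by
    have : (0 : ℝ) ≤ n := Nat.cast_nonneg n
    linarith
  rw [norm_mul, norm_pow, Real.norm_eq_abs, Real.norm_eq_abs,
    abs_of_nonneg (polylogCoeff_nonneg ht s _), polylogCoeff_cons_succ]
  have h1 : multipleHarmonic t n / ((n : ℝ) + 1) ^ s.natAbs ≤ 2 ^ t.length * ((n : ℝ) + 1) :=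
    calc _ ≤ multipleHarmonic t n := div_le_self h0 (one_le_pow₀ hx1)
      _ ≤ 2 ^ t.length * √((n : ℝ) + 1) := multipleHarmonic_le ht n
      _ ≤ _ := by
        gcongr
        exact Real.sqrt_le_iff.2 ⟨by positivity, by nlinarith⟩
  calc _ ≤ 2 ^ t.length * ((n : ℝ) + 1) * |x| ^ (n + 1) := by gcongr
    _ ≤ _ := by
      push_cast
      have : 0 ≤ 2 ^ t.length * |x| ^ (n + 1) := by positivity
      simp only [pow_one, pow_zero, one_mul]
      nlinarith

theorem hasAbelLimit_polylog_cons {s : ℤ} (hs : 0 < s) {t : List ℤ} (ht : ∀ s ∈ t, 0 < s)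
    (h : MZVConverges (-s :: t)) : HasAbelLimit (polylog (s :: t)) (mzv (-s :: t)) := by
  refine ⟨fun x hx => ?_, ?_⟩
  · simpa only [polylog, coeff_mk] using summable_polylogCoeff_cons ht x hx
  · have hl : Tendsto (multipleHarmonic (-s :: t)) atTop (𝓝 (mzv (-s :: t))) :=
      tendsto_nhds_limUnder h
    have hl' : Tendsto (fun N => ∑ n ∈ Finset.range N, (-1) ^ n * polylogCoeff (s :: t) n) atTop
        (𝓝 (mzv (-s :: t))) :=
      (tendsto_add_atTop_iff_nat 1).1 (hl.congr fun N => multipleHarmonic_neg_cons hs t N)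
    -- Abel's theorem at `1`, applied to the coefficients twisted by `(-1) ^ n`, gives the limit at
    -- `-1`.
    refine (Real.tendsto_tsum_powerSeries_nhdsWithin_lt hl').congr fun x => ?_
    refine tsum_congr fun n => ?_
    rw [polylog, coeff_mk, neg_pow]
    ring

theorem hasAbelLimit_polylog_one : HasAbelLimit (polylog [1]) (-Real.log 2) := by
  refine ⟨fun x hx => ?_, ?_⟩
  · simpa only [polylog, coeff_mk] using summable_polylogCoeff_cons (by simp) x hx
  · have hc : Tendsto (fun x : ℝ => -Real.log (1 + x)) (𝓝[<] 1) (𝓝 (-Real.log 2)) := by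
      have : ContinuousAt (fun x : ℝ => -Real.log (1 + x)) 1 := by
        refine ContinuousAt.neg (ContinuousAt.log (by fun_prop) (by norm_num))
      have h2 := this.tendsto
      rw [one_add_one_eq_two] at h2
      exact h2.mono_left nhdsWithin_le_nhds
    refine hc.congr' ?_
    filter_upwards [eventually_abs_neg_lt_one] with x hx
    have h := Real.hasSum_pow_div_log_of_abs_lt_one hx
    rw [sub_neg_eq_add] at h
    rw [← h.tsum_eq, Summable.tsum_eq_zero_add (f := fun n => coeff n (polylog [1]) * (-x) ^ n)]
    · simp only [polylog, coeff_mk, polylogCoeff_cons_succ]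
      rw [polylogCoeff_cons_zero one_pos, zero_mul, zero_add]
      refine tsum_congr fun n => ?_
      simp [multipleHarmonic]
      ring
    · simpa only [polylog, coeff_mk] using
        (summable_polylogCoeff_cons (s := 1) (t := []) (by simp) (-x) hx).of_norm

theorem hasAbelLimit_polylog_ones (d : ℕ) :
    HasAbelLimit (polylog (ones d)) ((-1) ^ d * (Real.log 2 ^ d / (d.factorial : ℝ))) := by
  have hd : (d.factorial : ℝ) ≠ 0 := by positivity
  have h : polylog (ones d) = C ((d.factorial : ℝ)⁻¹) * polylog [1] ^ d := by
    rw [← factorial_mul_polylog_ones, ← mul_assoc, ← map_natCast (C (R := ℝ)), ← map_mul,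
      inv_mul_cancel₀ hd, map_one, one_mul]
  rw [h]
  convert (hasAbelLimit_C _).mul (hasAbelLimit_polylog_one.pow d) using 1
  rw [neg_pow]
  ring

/-! ### The identity at `-1` -/

/-- The value at `-1` of the multiple polylogarithm of `({1}_d, 2, t)`. -/
noncomputable def altMzvOnesTwo (t : List ℤ) : ℕ → ℝ
  | 0 => mzv (-2 :: t)
  | d + 1 => mzv (-1 :: (ones d ++ 2 :: t))

theorem hasAbelLimit_polylogOnesTwo {t : List ℤ} (ht : ∀ s ∈ t, 0 < s) (d : ℕ) :
    HasAbelLimit (polylogOnesTwo t d) (altMzvOnesTwo t d) := by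
  cases d with
  | zero => exact hasAbelLimit_polylog_cons two_pos ht (mzvConverges_neg_two_cons ht)
  | succ d =>
    have h := pos_of_mem_ones_append_two_cons (d := d) ht
    exact hasAbelLimit_polylog_cons one_pos h (mzvConverges_neg_one_cons h)

theorem altConv_mzv_identity (m k p : ℕ) :
    (-1) ^ (k + p) * altConv (fun i => (-1) ^ i * (Real.log 2 ^ i / (i.factorial : ℝ)))
        (altMzvOnesTwo (ones p ++ 2 :: ones k)) (m + 1) +
      (-1) ^ (m + 1) * altConv (fun i => (-1) ^ i * (Real.log 2 ^ i / (i.factorial : ℝ)))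
        (altMzvOnesTwo (ones p ++ 2 :: ones m)) (k + 1) =
    (-1) ^ (m + k + p + 1) *
      altConv (altMzvOnesTwo (ones m)) (altMzvOnesTwo (ones k)) (p + 1) := by
  have hw : ∀ k, ∀ s ∈ ones p ++ 2 :: ones k, 0 < s :=
    fun k => pos_of_mem_ones_append_two_cons pos_of_mem_ones
  have hl := ((hasAbelLimit_neg_one_pow (k + p)).mul (HasAbelLimit.altConv
      hasAbelLimit_polylog_ones (hasAbelLimit_polylogOnesTwo (hw k)) (m + 1))).add
    ((hasAbelLimit_neg_one_pow (m + 1)).mul (HasAbelLimit.altConv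
      hasAbelLimit_polylog_ones (hasAbelLimit_polylogOnesTwo (hw m)) (k + 1)))
  have hr := (hasAbelLimit_neg_one_pow (m + k + p + 1)).mul (HasAbelLimit.altConv
    (hasAbelLimit_polylogOnesTwo (t := ones m) pos_of_mem_ones)
    (hasAbelLimit_polylogOnesTwo (t := ones k) pos_of_mem_ones) (p + 1))
  rw [altConv_polylog_identity] at hl
  exact hl.unique hr

/-- The signs of the convolution cancel those of `(-ln 2)^i`; the last term is split off because
only there does the leading entry become `-2`. -/
theorem altConv_log_altMzvOnesTwo (t : List ℤ) (n : ℕ) :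
    altConv (fun i => (-1) ^ i * (Real.log 2 ^ i / (i.factorial : ℝ))) (altMzvOnesTwo t) (n + 1) =
      ∑ i ∈ Finset.range (n + 1), Real.log 2 ^ i / (i.factorial : ℝ) *
        mzv (-1 :: (ones (n - i) ++ 2 :: t)) +
      Real.log 2 ^ (n + 1) / ((n + 1).factorial : ℝ) * mzv (-2 :: t) := by
  have hsign : ∀ i : ℕ, (-1 : ℝ) ^ i * (-1) ^ i = 1 := fun i => by rw [← mul_pow]; simp
  rw [altConv_eq_sum_range, Finset.sum_range_succ]
  congr 1
  · refine Finset.sum_congr rfl fun i hi => ?_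
    have hi' : n + 1 - i = n - i + 1 := by
      have := Finset.mem_range.1 hi
      omega
    rw [hi', altMzvOnesTwo, ← mul_assoc, hsign, one_mul]
  · rw [Nat.sub_self, altMzvOnesTwo, ← mul_assoc, hsign, one_mul]

theorem altConv_altMzvOnesTwo (s t : List ℤ) (p : ℕ) :
    altConv (altMzvOnesTwo s) (altMzvOnesTwo t) (p + 1) =
      mzv (-2 :: s) * mzv (-1 :: (ones p ++ 2 :: t)) +
      ∑ i ∈ Finset.Icc 1 p, (-1) ^ i * mzv (-1 :: (ones (i - 1) ++ 2 :: s)) *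
        mzv (-1 :: (ones (p - i) ++ 2 :: t)) +
      (-1) ^ (p + 1) * mzv (-1 :: (ones p ++ 2 :: s)) * mzv (-2 :: t) := by
  rw [altConv_eq_sum_range, Finset.sum_range_succ, Finset.sum_range_succ', add_comm (Finset.sum _ _)]
  congr 1
  · congr 1
    · simp [altMzvOnesTwo]
    · rw [← Finset.Ico_add_one_right_eq_Icc, Finset.sum_Ico_eq_sum_range, Nat.add_sub_cancel]
      refine Finset.sum_congr rfl fun i hi => ?_
      have h1 : p + 1 - (i + 1) = p - (1 + i) + 1 := by
        have := Finset.mem_range.1 hi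
        omega
      rw [h1, altMzvOnesTwo, altMzvOnesTwo, Nat.add_sub_cancel_left, add_comm 1 i]
  · rw [Nat.sub_self, altMzvOnesTwo, altMzvOnesTwo]

theorem theorem4p3 (m k p : ℕ) :
    -- all the series occurring in the identity converge
    ((∀ i ∈ Finset.range (m + 1),
        MZVConverges ([-1] ++ ones (m - i) ++ [2] ++ ones p ++ [2] ++ ones k)) ∧
      (∀ i ∈ Finset.range (k + 1),
        MZVConverges ([-1] ++ ones (k - i) ++ [2] ++ ones p ++ [2] ++ ones m)) ∧
      MZVConverges ([-2] ++ ones p ++ [2] ++ ones k) ∧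
      MZVConverges ([-2] ++ ones p ++ [2] ++ ones m) ∧
      MZVConverges ([-2] ++ ones m) ∧
      MZVConverges ([-2] ++ ones k) ∧
      MZVConverges ([-1] ++ ones p ++ [2] ++ ones k) ∧
      MZVConverges ([-1] ++ ones p ++ [2] ++ ones m) ∧
      (∀ i ∈ Finset.Icc 1 p,
        MZVConverges ([-1] ++ ones (i - 1) ++ [2] ++ ones m) ∧
        MZVConverges ([-1] ++ ones (p - i) ++ [2] ++ ones k))) ∧
    -- the identity
    (-1 : ℝ) ^ (k + p) * (m + 1).factorial * (k + 1).factorial *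
        ∑ i ∈ Finset.range (m + 1), Real.log 2 ^ i / (i.factorial : ℝ) *
          mzv ([-1] ++ ones (m - i) ++ [2] ++ ones p ++ [2] ++ ones k)
      + (-1 : ℝ) ^ (m + 1) * (k + 1).factorial * (m + 1).factorial *
        ∑ i ∈ Finset.range (k + 1), Real.log 2 ^ i / (i.factorial : ℝ) *
          mzv ([-1] ++ ones (k - i) ++ [2] ++ ones p ++ [2] ++ ones m)
      + (-1 : ℝ) ^ (k + p) * (k + 1).factorial * Real.log 2 ^ (m + 1) *
          mzv ([-2] ++ ones p ++ [2] ++ ones k)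
      + (-1 : ℝ) ^ (m + 1) * (m + 1).factorial * Real.log 2 ^ (k + 1) *
          mzv ([-2] ++ ones p ++ [2] ++ ones m)
    = (-1 : ℝ) ^ (m + k + p + 1) * (m + 1).factorial * (k + 1).factorial *
          mzv ([-2] ++ ones m) * mzv ([-1] ++ ones p ++ [2] ++ ones k)
      + (-1 : ℝ) ^ (m + k) * (k + 1).factorial * (m + 1).factorial *
          mzv ([-2] ++ ones k) * mzv ([-1] ++ ones p ++ [2] ++ ones m)
      + (-1 : ℝ) ^ (m + k + p + 1) * (k + 1).factorial * (m + 1).factorial *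
        ∑ i ∈ Finset.Icc 1 p, (-1 : ℝ) ^ i *
          mzv ([-1] ++ ones (i - 1) ++ [2] ++ ones m) *
          mzv ([-1] ++ ones (p - i) ++ [2] ++ ones k) := by
  simp only [List.append_assoc, List.cons_append, List.nil_append]
  have h0 : ∀ d, ∀ s ∈ ones d, 0 < s := fun d => pos_of_mem_ones
  have h1 : ∀ c d, ∀ s ∈ ones c ++ 2 :: ones d, 0 < s :=
    fun c d => pos_of_mem_ones_append_two_cons (h0 d)
  have h2 : ∀ b c d, ∀ s ∈ ones b ++ 2 :: (ones c ++ 2 :: ones d), 0 < s :=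
    fun b c d => pos_of_mem_ones_append_two_cons (h1 c d)
  refine ⟨⟨fun i _ => mzvConverges_neg_one_cons (h2 _ _ _),
    fun i _ => mzvConverges_neg_one_cons (h2 _ _ _),
    mzvConverges_neg_two_cons (h1 _ _), mzvConverges_neg_two_cons (h1 _ _),
    mzvConverges_neg_two_cons (h0 _), mzvConverges_neg_two_cons (h0 _),
    mzvConverges_neg_one_cons (h1 _ _), mzvConverges_neg_one_cons (h1 _ _),
    fun i _ => ⟨mzvConverges_neg_one_cons (h1 _ _), mzvConverges_neg_one_cons (h1 _ _)⟩⟩, ?_⟩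
  have h := altConv_mzv_identity m k p
  rw [altConv_log_altMzvOnesTwo, altConv_log_altMzvOnesTwo, altConv_altMzvOnesTwo] at h
  have hm : ((m + 1).factorial : ℝ) ≠ 0 := by positivity
  have hk : ((k + 1).factorial : ℝ) ≠ 0 := by positivity
  have hp : (-1 : ℝ) ^ (p + 1) * (-1) ^ (p + 1) = 1 := by rw [← mul_pow]; simp
  have hdm : ((m + 1).factorial : ℝ) * (Real.log 2 ^ (m + 1) / ((m + 1).factorial : ℝ)) =
      Real.log 2 ^ (m + 1) := mul_div_cancel₀ _ hm
  have hdk : ((k + 1).factorial : ℝ) * (Real.log 2 ^ (k + 1) / ((k + 1).factorial : ℝ)) =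
      Real.log 2 ^ (k + 1) := mul_div_cancel₀ _ hk
  have hsign : (-1 : ℝ) ^ (m + k + p + 1) * (-1) ^ (p + 1) = (-1) ^ (m + k) := by
    rw [show m + k + p + 1 = m + k + (p + 1) by ring, pow_add, mul_assoc, hp, mul_one]
  -- Scale by both factorials; `hdm` and `hdk` clear the denominators of the top powers of `ln 2`,
  -- and `hsign` simplifies the sign of the last term on the right.
  linear_combination ((m + 1).factorial : ℝ) * ((k + 1).factorial : ℝ) * h -
    (-1) ^ (k + p) * ((k + 1).factorial : ℝ) * mzv (-2 :: (ones p ++ 2 :: ones k)) * hdm -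
    (-1) ^ (m + 1) * ((m + 1).factorial : ℝ) * mzv (-2 :: (ones p ++ 2 :: ones m)) * hdk +
    ((m + 1).factorial : ℝ) * ((k + 1).factorial : ℝ) * mzv (-2 :: ones k) *
      mzv (-1 :: (ones p ++ 2 :: ones m)) * hsign
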